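/- Let $\mu>0$ and $0<\alpha<1$, and let $\partial_t$ be the distributional derivative in the complex space $L^2(-\infty,\infty)$ with domain $H^1(-\infty,\infty)=\{u\in L^2:\ u'\in L^2\}$. For an operator $A$ in a Banach space that generates a bounded strongly continuous semigroup $\{\mathcal V(\lambda)\}_{\lambda\ge 0}$, the fractional power of $A$ of order $\alpha$ in the sense of Bochner and Phillips is the generator (strong right derivative at $x=0$, with maximal domain) of the family $$W(x)w=\int_0^\infty \mathcal V(\lambda)w\,d\gamma_x(\lambda),\qquad x\ge 0,$$ where the positive measures $\gamma_x$ on $[0,\infty)$ are determined by $\exp(-xk^\alpha)=\int_0^\infty e^{-\lambda k}\,d\gamma_x(\lambda)$ for all $k>0$. Then the fractional power $(\mu^{1/2}\partial_t)^\alpha$ in this sense exists, is uniquely determined, and is the infinitesimal generator of a strongly continuous semigroup in $L^2(-\infty,\infty)$. Explicitly, it is the Fourier multiplier operator, with its maximal domain in $L^2$, whose symbol is $-(-i\mu^{1/2}\omega)^\alpha$ (principal branch; $\partial_t$ has symbol $i\omega$). The same holds for the operator $-\mu^{1/2}\partial_t$ in place of $\mu^{1/2}\partial_t$, where the symbol is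 $-(i\mu^{1/2}\omega)^\alpha$. In particular, for $\alpha=1/2$, the operators with symbols $-(-i\mu^{1/2}\omega)^{1/2}$ and $-(i\mu^{1/2}\omega)^{1/2}$ are infinitesimal generators in $L^2(-\infty,\infty)$; the second one is a square root of $\mu^{1/2}\partial_t$. -/

import Mathlib

open Filter Topology MeasureTheory FourierTransform
open scoped NNReal ENNReal SchwartzMap LineDeriv

/-- The complex Hilbert space `L²(-∞, ∞)`. -/
abbrev L2R : Type := Lp (α := ℝ) ℂ 2

/-- A strongly continuous semigroup (`C₀`-semigroup) of bounded operators. -/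
structure IsC0Semigroup {X : Type*} [NormedAddCommGroup X] [NormedSpace ℂ X]
    (T : ℝ≥0 → X →L[ℂ] X) : Prop where
  map_zero : T 0 = ContinuousLinearMap.id ℂ X
  map_add : ∀ s t : ℝ≥0, T (s + t) = (T s).comp (T t)
  continuous : ∀ u : X, Continuous fun t => T t u

/-- The (possibly unbounded) operator `A` is the right derivative at `0` of the operator family
`T`: its domain consists of exactly those `u` for which `h⁻¹ (T h u - u)` converges as `h → 0+`,
and `A u` is the limit. -/
def IsGeneratorOf {X : Type*} [NormedAddCommGroup X] [NormedSpace ℂ X]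
    (A : X →ₗ.[ℂ] X) (T : ℝ≥0 → X →L[ℂ] X) : Prop :=
  ∀ u v : X, (u, v) ∈ A.graph ↔
    Tendsto (fun h : ℝ≥0 => ((h : ℝ) : ℂ)⁻¹ • (T h u - u)) (𝓝[>] 0) (𝓝 v)

/-- `A` is the infinitesimal generator of some strongly continuous semigroup. -/
def IsInfinitesimalGenerator {X : Type*} [NormedAddCommGroup X] [NormedSpace ℂ X]
    (A : X →ₗ.[ℂ] X) : Prop :=
  ∃ T : ℝ≥0 → X →L[ℂ] X, IsC0Semigroup T ∧ IsGeneratorOf A T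

/-- `γ` is a (positive) measure on `[0, ∞)` with
`∫ exp (-l k) dγ(l) = exp (-x k ^ α)` for all `k > 0`. -/
def HasStableLaplace (α : ℝ) (x : ℝ≥0) (γ : Measure ℝ≥0) : Prop :=
  ∀ k : ℝ, 0 < k →
    ∫ l : ℝ≥0, Real.exp (-((l : ℝ) * k)) ∂γ = Real.exp (-((x : ℝ) * k ^ α))

/-- `B` is the fractional power of order `α` of `A` in the sense of Bochner and Phillips:
`A` generates a bounded strongly continuous semigroup `V`, and `B` is the generator of the
subordinate family `W x u = ∫ V l u dγ_x(l)`, where the measures `γ_x` are determined by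
`∫ exp (-l k) dγ_x(l) = exp (-x k ^ α)`. -/
def IsBochnerPhillipsPower {X : Type*} [NormedAddCommGroup X] [NormedSpace ℂ X]
    (α : ℝ) (A B : X →ₗ.[ℂ] X) : Prop :=
  ∃ (V : ℝ≥0 → X →L[ℂ] X) (γ : ℝ≥0 → Measure ℝ≥0) (W : ℝ≥0 → X →L[ℂ] X),
    IsC0Semigroup V ∧ (∃ M : ℝ, ∀ t, ‖V t‖ ≤ M) ∧ IsGeneratorOf A V ∧
    (∀ x, HasStableLaplace α x (γ x)) ∧
    (∀ x u, W x u = ∫ l, V l u ∂(γ x)) ∧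
    IsGeneratorOf B W

/-- The pairs `(u, v)` in `L²` such that `v` is the distributional derivative of `u`. -/
noncomputable def weakDerivGraph : Submodule ℂ (L2R × L2R) where
  carrier := {p | ∂_{(1 : ℝ)} (p.1 : 𝓢'(ℝ, ℂ)) = (p.2 : 𝓢'(ℝ, ℂ))}
  zero_mem' := by
    simp only [Set.mem_ofPred_eq, ← Lp.toTemperedDistributionCLM_apply, Prod.fst_zero,
      Prod.snd_zero, map_zero]
    exact (LineDeriv.lineDerivOpCLM ℂ 𝓢'(ℝ, ℂ) (1 : ℝ)).map_zero
  add_mem' := by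
    intro p q hp hq
    simp only [Set.mem_ofPred_eq, ← Lp.toTemperedDistributionCLM_apply, Prod.fst_add,
      Prod.snd_add, map_add, LineDeriv.lineDerivOp_add] at hp hq ⊢
    rw [hp, hq]
  smul_mem' := by
    intro a p hp
    simp only [Set.mem_ofPred_eq, ← Lp.toTemperedDistributionCLM_apply, Prod.smul_fst,
      Prod.smul_snd, map_smul, LineDeriv.lineDerivOp_smul] at hp ⊢
    rw [hp]

/-- The operator `∂_t` in `L²(-∞, ∞)` with domain `H¹(-∞, ∞)`, i.e. all `u ∈ L²` whose
distributional derivative is in `L²`. -/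
noncomputable def timeDeriv : L2R →ₗ.[ℂ] L2R :=
  weakDerivGraph.toLinearPMap

theorem mem_graph_timeDeriv (u v : L2R) :
    (u, v) ∈ timeDeriv.graph ↔ ∂_{(1 : ℝ)} (u : 𝓢'(ℝ, ℂ)) = (v : 𝓢'(ℝ, ℂ)) := by
  have h : timeDeriv.graph = weakDerivGraph := by
    refine Submodule.toLinearPMap_graph_eq weakDerivGraph ?_
    rintro ⟨a, b⟩ hp (rfl : a = 0)
    have h0 := weakDerivGraph.zero_mem
    have e1 : ∂_{(1 : ℝ)} ((0 : L2R) : 𝓢'(ℝ, ℂ)) = (b : 𝓢'(ℝ, ℂ)) := hp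
    have e2 : ∂_{(1 : ℝ)} ((0 : L2R) : 𝓢'(ℝ, ℂ)) = ((0 : L2R) : 𝓢'(ℝ, ℂ)) := h0
    have hinj := LinearMap.ker_eq_bot.mp
      (Lp.ker_toTemperedDistributionCLM_eq_bot (F := ℂ) (μ := (volume : Measure ℝ)) (p := 2))
    exact hinj (e1.symm.trans e2)
  rw [h]
  rfl

/-! The Fourier transform is unitary and turns `c • timeDeriv` into multiplication by `m ξ = 2πi c
ξ`, so that `ω = 2πξ`. Whenever `Re m ≤ 0`, multiplication by `exp (t m)` is a contraction semigroup
whose generator is multiplication by `m` on its maximal domain (`isGeneratorOf_multiplierOp`).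
Averaging over a measure with Laplace transform `exp (-x k ^ α)` replaces `exp (l m)` by `exp (-x
(-m) ^ α)`, again such a semigroup since `Re (-m) ^ α ≥ 0`; its generator is the claimed multiplier.

Three facts carry this. A densely defined generator determines a bounded semigroup, so the power
does not depend on choices (`IsC0Semigroup.eq_of_isGeneratorOf`). The Laplace identity, given only
for `k > 0`, extends to the imaginary axis, where `-m` lives (`HasStableLaplace.integral_cexp`).
Stable measures exist (`exists_hasStableLaplace`): under `y = exp (-l)` they become laws on the
compact interval `[0, 1]` with moments `exp (-x k ^ α)`, obtained as limits of powers of the moments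
`1 - (1 - exp (-h k)) ^ α`, whose binomial coefficients are nonnegative. -/

/-- Dominated convergence in `L²`. -/
theorem tendsto_Lp_two_of_dominated {X ι : Type*} [MeasurableSpace X] {ν : Measure X}
    {l : Filter ι} [l.IsCountablyGenerated] {F : ι → Lp ℂ 2 ν} {f : Lp ℂ 2 ν}
    {G : ι → X → ℂ} {g : X → ℝ} (hg : MemLp g 2 ν) (hFG : ∀ i, F i =ᵐ[ν] G i)
    (hb : ∀ i, ∀ᵐ x ∂ν, ‖G i x‖ ≤ g x)
    (hlim : ∀ᵐ x ∂ν, Tendsto (fun i => G i x) l (𝓝 (f x))) : Tendsto F l (𝓝 f) := by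
  rw [Lp.tendsto_Lp_iff_tendsto_eLpNorm']
  have hE : ∀ i, eLpNorm (⇑(F i) - ⇑f) 2 ν =
      (∫⁻ x, ‖G i x - f x‖ₑ ^ (2 : ℝ) ∂ν) ^ (1 / 2 : ℝ) := by
    intro i
    rw [eLpNorm_eq_lintegral_rpow_enorm_toReal (by norm_num) (by norm_num)]
    simp only [ENNReal.toReal_ofNat]
    congr 1
    refine lintegral_congr_ae ?_
    filter_upwards [hFG i] with x hx
    simp [hx]
  simp only [hE]
  have h0 : (0 : ℝ≥0∞) = 0 ^ (1 / 2 : ℝ) := by simp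
  rw [h0]
  refine ((ENNReal.continuous_rpow_const (y := (1 / 2 : ℝ))).tendsto 0).comp ?_
  have hz : (0 : ℝ≥0∞) = ∫⁻ _ : X, 0 ∂ν := by simp
  rw [hz]
  have hG : MemLp (fun x => ‖f x‖ + g x) 2 ν := (Lp.memLp f).norm.add hg
  refine tendsto_of_seq_tendsto fun s hs => tendsto_lintegral_of_dominated_convergence'
    (fun x => ‖‖f x‖ + g x‖ₑ ^ (2 : ℝ)) (fun n => ?_) (fun n => ?_) ?_ ?_
  · let i := s n
    have : AEStronglyMeasurable (G i) ν := (Lp.aestronglyMeasurable (F i)).congr (hFG i)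
    exact ((this.sub (Lp.aestronglyMeasurable f)).enorm).pow_const _
  · filter_upwards [hb (s n)] with x hx
    refine ENNReal.rpow_le_rpow ?_ (by norm_num)
    rw [enorm_le_iff_norm_le]
    calc ‖G (s n) x - f x‖ ≤ ‖G (s n) x‖ + ‖f x‖ := norm_sub_le _ _
      _ ≤ ‖f x‖ + g x := by linarith
      _ ≤ _ := Real.le_norm_self _
  · have := hG.eLpNorm_lt_top
    rw [eLpNorm_lt_top_iff_lintegral_rpow_enorm_lt_top (by norm_num) (by norm_num)] at this
    simpa using this.ne
  · filter_upwards [hlim] with x hx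
    have : Tendsto (fun i => ‖G i x - f x‖ₑ ^ (2 : ℝ)) l (𝓝 (‖f x - f x‖ₑ ^ (2 : ℝ))) :=
      ((ENNReal.continuous_rpow_const (y := (2 : ℝ))).tendsto _).comp
        ((hx.sub tendsto_const_nhds).enorm)
    simpa [Function.comp_def] using this.comp hs

/-! ### Bounded Fourier multipliers on `L²` -/

theorem exists_fourierMultiplier (φ : ℝ → ℂ) (hφ : Measurable φ) (hb : ∀ ξ, ‖φ ξ‖ ≤ 1) :
    ∃ T : L2R →L[ℂ] L2R, (∀ u, ‖T u‖ ≤ ‖u‖) ∧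
      ∀ u, (𝓕 (T u) : L2R) =ᵐ[volume] fun ξ => φ ξ * (𝓕 u : L2R) ξ := by
  have hmem : ∀ u : L2R, MemLp (fun ξ => φ ξ * u ξ) 2 volume := fun u =>
    (Lp.memLp u).of_le (hφ.aestronglyMeasurable.mul (Lp.aestronglyMeasurable u))
      (Eventually.of_forall fun ξ => by
        rw [norm_mul]; exact mul_le_of_le_one_left (norm_nonneg _) (hb ξ))
  let M : L2R →ₗ[ℂ] L2R :=
    { toFun := fun u => (hmem u).toLp
      map_add' := fun u v => by
        refine Lp.ext ?_
        filter_upwards [(hmem (u + v)).coeFn_toLp, (hmem u).coeFn_toLp, (hmem v).coeFn_toLp,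
          Lp.coeFn_add u v, Lp.coeFn_add (hmem u).toLp (hmem v).toLp] with ξ h1 h2 h3 h4 h5
        rw [h1, h5, Pi.add_apply, h2, h3, h4, Pi.add_apply, mul_add]
      map_smul' := fun a u => by
        refine Lp.ext ?_
        filter_upwards [(hmem (a • u)).coeFn_toLp, (hmem u).coeFn_toLp,
          Lp.coeFn_smul a u, Lp.coeFn_smul a (hmem u).toLp] with ξ h1 h2 h4 h5
        simp only [RingHom.id_apply]
        rw [h1, h5, Pi.smul_apply, h2, h4, Pi.smul_apply, smul_eq_mul, smul_eq_mul]
        ring }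
  have hM : ∀ u, ‖M u‖ ≤ 1 * ‖u‖ := fun u => by
    rw [one_mul]
    refine Lp.norm_le_norm_of_ae_le ?_
    filter_upwards [(hmem u).coeFn_toLp] with ξ h1
    have h2 : M u = (hmem u).toLp := rfl
    rw [h2, h1, norm_mul]
    exact mul_le_of_le_one_left (norm_nonneg _) (hb ξ)
  let U := Lp.fourierTransformₗᵢ ℝ ℂ
  refine ⟨U.symm.toContinuousLinearEquiv.toContinuousLinearMap ∘L
    (M.mkContinuous 1 hM) ∘L U.toContinuousLinearEquiv.toContinuousLinearMap, ?_, ?_⟩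
  · intro u
    change ‖U.symm (M (U u))‖ ≤ _
    rw [U.symm.norm_map]
    exact (hM _).trans (by rw [one_mul, U.norm_map])
  · intro u
    have : (𝓕 (U.symm (M (U u))) : L2R) = M (𝓕 u) := U.apply_symm_apply _
    change (𝓕 (U.symm (M (U u))) : L2R) =ᵐ[volume] _
    rw [this]
    exact (hmem (𝓕 u)).coeFn_toLp

/-- The Fourier multiplier with a symbol of absolute value at most one. -/
noncomputable def fourierMultiplier (φ : ℝ → ℂ) (hφ : Measurable φ) (hb : ∀ ξ, ‖φ ξ‖ ≤ 1) :
    L2R →L[ℂ] L2R :=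
  (exists_fourierMultiplier φ hφ hb).choose

theorem norm_fourierMultiplier_apply_le {φ : ℝ → ℂ} (hφ : Measurable φ) (hb : ∀ ξ, ‖φ ξ‖ ≤ 1)
    (u : L2R) : ‖fourierMultiplier φ hφ hb u‖ ≤ ‖u‖ :=
  (exists_fourierMultiplier φ hφ hb).choose_spec.1 u

theorem fourier_fourierMultiplier {φ : ℝ → ℂ} (hφ : Measurable φ) (hb : ∀ ξ, ‖φ ξ‖ ≤ 1)
    (u : L2R) :
    (𝓕 (fourierMultiplier φ hφ hb u) : L2R) =ᵐ[volume] fun ξ => φ ξ * (𝓕 u : L2R) ξ :=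
  (exists_fourierMultiplier φ hφ hb).choose_spec.2 u

theorem Lp_fourier_injective : Function.Injective (fun u : L2R => (𝓕 u : L2R)) :=
  (Lp.fourierTransformₗᵢ ℝ ℂ).injective

theorem eq_of_fourier_ae_eq {u v : L2R} (h : (𝓕 u : L2R) =ᵐ[volume] (𝓕 v : L2R)) : u = v :=
  Lp_fourier_injective (Lp.ext h)

theorem tendsto_of_tendsto_fourier {ι : Type*} {l : Filter ι} {F : ι → L2R} {f : L2R}
    (h : Tendsto (fun i => (𝓕 (F i) : L2R)) l (𝓝 (𝓕 f))) : Tendsto F l (𝓝 f) := by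
  have := ((Lp.fourierTransformₗᵢ ℝ ℂ).symm.continuous.tendsto _).comp h
  have e : ∀ u : L2R, (Lp.fourierTransformₗᵢ ℝ ℂ).symm (𝓕 u : L2R) = u :=
    (Lp.fourierTransformₗᵢ ℝ ℂ).symm_apply_apply
  rw [e] at this
  exact this.congr fun i => e _

theorem coeFn_fourier_add (u v : L2R) :
    (𝓕 (u + v) : L2R) =ᵐ[volume] fun ξ => (𝓕 u : L2R) ξ + (𝓕 v : L2R) ξ := by
  rw [FourierTransform.fourier_add]
  exact Lp.coeFn_add _ _

theorem coeFn_fourier_sub (u v : L2R) :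
    (𝓕 (u - v) : L2R) =ᵐ[volume] fun ξ => (𝓕 u : L2R) ξ - (𝓕 v : L2R) ξ := by
  have h : (𝓕 (u - v) : L2R) = 𝓕 u - 𝓕 v := (Lp.fourierTransformₗᵢ ℝ ℂ).map_sub u v
  rw [h]
  exact Lp.coeFn_sub _ _

theorem coeFn_fourier_smul (a : ℂ) (u : L2R) :
    (𝓕 (a • u) : L2R) =ᵐ[volume] fun ξ => a * (𝓕 u : L2R) ξ := by
  rw [FourierTransform.fourier_smul]
  exact Lp.coeFn_smul _ _

/-! ### Multiplier operators with maximal domain and their semigroups -/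

/-- The pairs `(u, v)` in `L²` whose Fourier transforms satisfy `𝓕 v = m * 𝓕 u`. -/
noncomputable def multiplierGraph (m : ℝ → ℂ) : Submodule ℂ (L2R × L2R) where
  carrier := {p | (𝓕 p.2 : L2R) =ᵐ[volume] fun ξ => m ξ * (𝓕 p.1 : L2R) ξ}
  zero_mem' := by
    have h : (𝓕 (0 : L2R) : L2R) = 0 := (Lp.fourierTransformₗᵢ ℝ ℂ).map_zero
    change (𝓕 (0 : L2R) : L2R) =ᵐ[volume] fun ξ => m ξ * (𝓕 (0 : L2R) : L2R) ξ
    rw [h]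
    exact Eventually.of_forall fun ξ => by simp
  add_mem' := by
    rintro ⟨u, v⟩ ⟨u', v'⟩ h h'
    change (𝓕 (v + v') : L2R) =ᵐ[volume] fun ξ => m ξ * (𝓕 (u + u') : L2R) ξ
    filter_upwards [coeFn_fourier_add v v', coeFn_fourier_add u u', h, h'] with ξ h1 h2 h3 h4
    rw [h1, h2, h3, h4, mul_add]
  smul_mem' := by
    rintro a ⟨u, v⟩ h
    change (𝓕 (a • v) : L2R) =ᵐ[volume] fun ξ => m ξ * (𝓕 (a • u) : L2R) ξ
    filter_upwards [coeFn_fourier_smul a v, coeFn_fourier_smul a u, h] with ξ h1 h2 h3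
    rw [h1, h2, h3]
    ring

/-- The Fourier multiplier operator in `L²` with symbol `m` and maximal domain. -/
noncomputable def multiplierOp (m : ℝ → ℂ) : L2R →ₗ.[ℂ] L2R :=
  (multiplierGraph m).toLinearPMap

theorem mem_graph_multiplierOp (m : ℝ → ℂ) (u v : L2R) :
    (u, v) ∈ (multiplierOp m).graph ↔
      (𝓕 v : L2R) =ᵐ[volume] fun ξ => m ξ * (𝓕 u : L2R) ξ := by
  have h : (multiplierOp m).graph = multiplierGraph m := by
    refine Submodule.toLinearPMap_graph_eq _ ?_
    rintro ⟨a, b⟩ hp (rfl : a = 0)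
    have h0 : (𝓕 (0 : L2R) : L2R) =ᵐ[volume] fun ξ => m ξ * (𝓕 (0 : L2R) : L2R) ξ :=
      (multiplierGraph m).zero_mem
    have hb : (𝓕 b : L2R) =ᵐ[volume] fun ξ => m ξ * (𝓕 (0 : L2R) : L2R) ξ := hp
    exact eq_of_fourier_ae_eq (hb.trans h0.symm)
  rw [h]
  rfl

section Semigroup

variable {m : ℝ → ℂ}

theorem norm_exp_mul_le_one (hre : ∀ ξ, (m ξ).re ≤ 0) (t : ℝ≥0) (ξ : ℝ) :
    ‖Complex.exp ((t : ℝ) * m ξ)‖ ≤ 1 := by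
  rw [Complex.norm_exp, Real.exp_le_one_iff, Complex.re_ofReal_mul]
  exact mul_nonpos_of_nonneg_of_nonpos t.2 (hre ξ)

/-- The semigroup of Fourier multipliers with symbols `exp (t m)`. -/
noncomputable def multiplierSemigroup (hm : Measurable m) (hre : ∀ ξ, (m ξ).re ≤ 0) (t : ℝ≥0) :
    L2R →L[ℂ] L2R :=
  fourierMultiplier (fun ξ => Complex.exp ((t : ℝ) * m ξ)) (by fun_prop)
    (norm_exp_mul_le_one hre t)

variable (hm : Measurable m) (hre : ∀ ξ, (m ξ).re ≤ 0)

theorem fourier_multiplierSemigroup (t : ℝ≥0) (u : L2R) :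
    (𝓕 (multiplierSemigroup hm hre t u) : L2R) =ᵐ[volume]
      fun ξ => Complex.exp ((t : ℝ) * m ξ) * (𝓕 u : L2R) ξ :=
  fourier_fourierMultiplier _ _ u

theorem norm_multiplierSemigroup_le (t : ℝ≥0) : ‖multiplierSemigroup hm hre t‖ ≤ 1 :=
  ContinuousLinearMap.opNorm_le_bound _ zero_le_one fun u => by
    rw [one_mul]
    exact norm_fourierMultiplier_apply_le _ _ u

theorem isC0Semigroup_multiplierSemigroup : IsC0Semigroup (multiplierSemigroup hm hre) where
  map_zero := by
    ext1 u
    refine eq_of_fourier_ae_eq ?_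
    filter_upwards [fourier_multiplierSemigroup hm hre 0 u] with ξ h
    simp [h]
  map_add s t := by
    ext1 u
    refine eq_of_fourier_ae_eq ?_
    change _ =ᵐ[volume]
      (𝓕 (multiplierSemigroup hm hre s (multiplierSemigroup hm hre t u)) : L2R)
    filter_upwards [fourier_multiplierSemigroup hm hre (s + t) u,
      fourier_multiplierSemigroup hm hre s (multiplierSemigroup hm hre t u),
      fourier_multiplierSemigroup hm hre t u] with ξ h1 h2 h3
    rw [h1, h2, h3, ← mul_assoc, ← Complex.exp_add]
    push_cast
    ring_nf
  continuous u := by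
    refine continuous_iff_continuousAt.2 fun t => tendsto_of_tendsto_fourier ?_
    refine tendsto_Lp_two_of_dominated (Lp.memLp (𝓕 u : L2R)).norm
      (fun s => fourier_multiplierSemigroup hm hre s u) ?_ ?_
    · refine fun s => Eventually.of_forall fun ξ => ?_
      rw [norm_mul]
      exact mul_le_of_le_one_left (norm_nonneg _) (norm_exp_mul_le_one hre s ξ)
    · filter_upwards [fourier_multiplierSemigroup hm hre t u] with ξ h
      rw [h]
      have : Continuous fun s : ℝ≥0 => Complex.exp ((s : ℝ) * m ξ) * (𝓕 u : L2R) ξ := by fun_prop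
      exact this.tendsto t

theorem norm_exp_sub_one_le_of_re_nonpos {z : ℂ} (hz : z.re ≤ 0) : ‖Complex.exp z - 1‖ ≤ ‖z‖ := by
  have h := (convex_halfSpace_re_le 0).norm_image_sub_le_of_norm_deriv_le
    (f := Complex.exp) (x := 0) (y := z) (C := 1) (fun x _ => Complex.differentiableAt_exp)
    (fun x hx => by
      rw [Complex.deriv_exp, Complex.norm_exp]
      exact Real.exp_le_one_iff.2 hx) (by simp) hz
  simpa using h

theorem tendsto_inv_mul_exp_sub_one (z : ℂ) :
    Tendsto (fun h : ℝ≥0 => ((h : ℝ) : ℂ)⁻¹ * (Complex.exp ((h : ℝ) * z) - 1)) (𝓝[>] 0)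
      (𝓝 z) := by
  have hd : HasDerivAt (fun w : ℂ => Complex.exp (w * z)) z 0 := by
    simpa using ((hasDerivAt_id (0 : ℂ)).mul_const z).cexp
  have hs := hd.tendsto_slope_zero
  have ht : Tendsto (fun h : ℝ≥0 => ((h : ℝ) : ℂ)) (𝓝[>] 0) (𝓝[≠] 0) := by
    refine tendsto_nhdsWithin_iff.2 ⟨?_, ?_⟩
    · have : Continuous fun h : ℝ≥0 => ((h : ℝ) : ℂ) := by fun_prop
      simpa using (this.tendsto 0).mono_left nhdsWithin_le_nhds
    · filter_upwards [self_mem_nhdsWithin] with h hh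
      simpa using (ne_of_gt hh)
  simpa [Function.comp_def] using hs.comp ht

theorem fourier_difference_quotient (h : ℝ≥0) (u : L2R) :
    (𝓕 (((h : ℝ) : ℂ)⁻¹ • (multiplierSemigroup hm hre h u - u)) : L2R) =ᵐ[volume]
      fun ξ => ((h : ℝ) : ℂ)⁻¹ * (Complex.exp ((h : ℝ) * m ξ) - 1) * (𝓕 u : L2R) ξ := by
  filter_upwards [coeFn_fourier_smul ((h : ℝ) : ℂ)⁻¹ (multiplierSemigroup hm hre h u - u),
    coeFn_fourier_sub (multiplierSemigroup hm hre h u) u,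
    fourier_multiplierSemigroup hm hre h u] with ξ h1 h2 h3
  rw [h1, h2, h3]
  ring

/-- On the maximal domain, `|exp z - 1| ≤ |z|` for `Re z ≤ 0` dominates the difference quotients by
`|m 𝓕u| = |𝓕v|`. Conversely, an `L²` limit of the quotients is an a.e. limit along a subsequence,
hence equals `m 𝓕u`; so the domain is no larger. -/
theorem isGeneratorOf_multiplierOp :
    IsGeneratorOf (multiplierOp m) (multiplierSemigroup hm hre) := by
  intro u v
  rw [mem_graph_multiplierOp]
  constructor
  · intro huv
    refine tendsto_of_tendsto_fourier ?_
    refine tendsto_Lp_two_of_dominated (Lp.memLp (𝓕 v : L2R)).norm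
      (fun h => fourier_difference_quotient hm hre h u) ?_ ?_
    · intro h
      -- The bound is required for every index, including `h = 0`, where `0⁻¹ = 0` makes the
      -- quotient vanish.
      rcases eq_or_ne h 0 with rfl | hh0
      · simp
      have hh : (0 : ℝ) < h := NNReal.coe_pos.2 (pos_iff_ne_zero.2 hh0)
      filter_upwards [huv] with ξ hξ
      rw [hξ, norm_mul, norm_mul, norm_mul]
      refine mul_le_mul_of_nonneg_right ?_ (norm_nonneg _)
      have hle := norm_exp_sub_one_le_of_re_nonpos (z := (h : ℝ) * m ξ) (by
        rw [Complex.re_ofReal_mul]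
        exact mul_nonpos_of_nonneg_of_nonpos hh.le (hre ξ))
      rw [norm_mul, Complex.norm_real, Real.norm_of_nonneg hh.le] at hle
      rw [norm_inv, Complex.norm_real, Real.norm_of_nonneg hh.le, inv_mul_le_iff₀ hh]
      exact hle
    · filter_upwards [huv] with ξ hξ
      rw [hξ]
      exact (tendsto_inv_mul_exp_sub_one (m ξ)).mul_const _
  · intro hlim
    have hF : Tendsto (fun h : ℝ≥0 =>
        (𝓕 (((h : ℝ) : ℂ)⁻¹ • (multiplierSemigroup hm hre h u - u)) : L2R)) (𝓝[>] 0) (𝓝 (𝓕 v)) :=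
      ((Lp.fourierTransformₗᵢ ℝ ℂ).continuous.tendsto v).comp hlim
    obtain ⟨s, hs⟩ := (𝓝[>] (0 : ℝ≥0)).exists_seq_tendsto
    have hseq := hF.comp hs
    obtain ⟨r, hr, hae⟩ := (tendstoInMeasure_of_tendsto_Lp hseq).exists_seq_tendsto_ae
    have hq : ∀ᵐ ξ, ∀ n, _ := ae_all_iff.2 fun n : ℕ =>
      fourier_difference_quotient hm hre (s (r n)) u
    filter_upwards [hae, hq] with ξ h1 h2
    have h3 := ((tendsto_inv_mul_exp_sub_one (m ξ)).mul_const ((𝓕 u : L2R) ξ)).comp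
      (hs.comp hr.tendsto_atTop)
    refine tendsto_nhds_unique h1 (h3.congr fun n => ?_)
    exact (h2 n).symm

/-- The maximal domain of a Fourier multiplier operator is dense. -/
theorem dense_domain_multiplierOp (hm : Measurable m) :
    Dense {u : L2R | ∃ v, (u, v) ∈ (multiplierOp m).graph} := by
  intro u
  have hmeas : ∀ n : ℕ, MeasurableSet {ξ | ‖m ξ‖ ≤ n} := fun n =>
    measurableSet_le hm.norm measurable_const
  -- Cut off the frequencies where the symbol exceeds `n`.
  let φ : ℕ → ℝ → ℂ := fun n => Set.indicator {ξ | ‖m ξ‖ ≤ n} 1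
  have hφ : ∀ n, Measurable (φ n) := fun n => measurable_one.indicator (hmeas n)
  have hφ1 : ∀ n ξ, ‖φ n ξ‖ ≤ 1 := fun n ξ => by
    simp only [φ, Set.indicator_apply]
    split_ifs <;> simp
  refine mem_closure_of_tendsto (b := atTop) (f := fun n => fourierMultiplier (φ n) (hφ n) (hφ1 n) u)
    ?_ (Eventually.of_forall fun n => ?_)
  · refine tendsto_of_tendsto_fourier ?_
    refine tendsto_Lp_two_of_dominated (Lp.memLp (𝓕 u : L2R)).norm
      (fun n => fourier_fourierMultiplier (hφ n) (hφ1 n) u) ?_ ?_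
    · refine fun n => Eventually.of_forall fun ξ => ?_
      rw [norm_mul]
      exact mul_le_of_le_one_left (norm_nonneg _) (hφ1 n ξ)
    · refine Eventually.of_forall fun ξ => tendsto_const_nhds.congr' ?_
      filter_upwards [eventually_ge_atTop ⌈‖m ξ‖⌉₊] with n hn
      have : ‖m ξ‖ ≤ n := (Nat.le_ceil _).trans (by exact_mod_cast hn)
      simp [φ, this]
  -- `m * φ n` is bounded by `n`; dividing by `n + 1`, which is never zero, gives an admissible
  -- symbol of size at most one, and the factor is restored afterwards.
  · have hψ : Measurable fun ξ => ((n : ℂ) + 1)⁻¹ * (m ξ * φ n ξ) := by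
      have := hφ n
      fun_prop
    have hn : ((n : ℂ) + 1) ≠ 0 := by exact_mod_cast n.succ_ne_zero
    have hψ1 : ∀ ξ, ‖((n : ℂ) + 1)⁻¹ * (m ξ * φ n ξ)‖ ≤ 1 := fun ξ => by
      rw [norm_mul, norm_inv]
      have e : ‖(n : ℂ) + 1‖ = n + 1 := by
        rw [← Nat.cast_succ, Complex.norm_natCast]; simp
      rw [e, inv_mul_le_iff₀ (by positivity), mul_one]
      simp only [φ, Set.indicator_apply]
      split_ifs with h
      · have : ‖m ξ‖ ≤ n := h
        simp
        linarith
      · simp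
        positivity
    refine ⟨((n : ℂ) + 1) • fourierMultiplier _ hψ hψ1 u, ?_⟩
    rw [mem_graph_multiplierOp]
    filter_upwards [coeFn_fourier_smul ((n : ℂ) + 1) (fourierMultiplier _ hψ hψ1 u),
      fourier_fourierMultiplier hψ hψ1 u, fourier_fourierMultiplier (hφ n) (hφ1 n) u]
      with ξ h1 h2 h3
    rw [h1, h2, h3]
    field_simp

end Semigroup

/-! ### Subordination on the Fourier side, and uniqueness of the semigroup -/

/-- The Fourier transform of a mixture of the operators of a multiplier semigroup. -/
theorem fourier_integral_multiplierSemigroup {m : ℝ → ℂ} (hm : Measurable m)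
    (hre : ∀ ξ, (m ξ).re ≤ 0) (γ : Measure ℝ≥0) [IsFiniteMeasure γ] (u : L2R) :
    (𝓕 (∫ l, multiplierSemigroup hm hre l u ∂γ) : L2R) =ᵐ[volume]
      fun ξ => (∫ l : ℝ≥0, Complex.exp ((l : ℝ) * m ξ) ∂γ) * (𝓕 u : L2R) ξ := by
  set f : L2R := 𝓕 u with hf
  have hmeas : Measurable fun p : ℝ≥0 × ℝ => Complex.exp ((p.1 : ℝ) * m p.2) := by fun_prop
  have hφ : StronglyMeasurable fun ξ => ∫ l : ℝ≥0, Complex.exp ((l : ℝ) * m ξ) ∂γ :=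
    hmeas.stronglyMeasurable.integral_prod_left'
  have hh : MemLp (fun ξ => (∫ l : ℝ≥0, Complex.exp ((l : ℝ) * m ξ) ∂γ) * f ξ) 2 volume := by
    refine (Lp.memLp f).of_le_mul (c := γ.real Set.univ)
      (hφ.aestronglyMeasurable.mul (Lp.aestronglyMeasurable f)) (Eventually.of_forall fun ξ => ?_)
    rw [norm_mul]
    refine mul_le_mul_of_nonneg_right ?_ (norm_nonneg _)
    simpa using norm_integral_le_of_norm_le_const
      (Eventually.of_forall fun l : ℝ≥0 => norm_exp_mul_le_one hre l ξ) (μ := γ)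
  have hint : Integrable (fun l => multiplierSemigroup hm hre l u) γ := by
    refine Integrable.of_bound
      ((isC0Semigroup_multiplierSemigroup hm hre).continuous u).aestronglyMeasurable ‖u‖
      (Eventually.of_forall fun l => ?_)
    exact norm_fourierMultiplier_apply_le _ _ u
  have hcomm : (𝓕 (∫ l, multiplierSemigroup hm hre l u ∂γ) : L2R) =
      ∫ l, (𝓕 (multiplierSemigroup hm hre l u) : L2R) ∂γ :=
    ((Lp.fourierTransformₗᵢ ℝ ℂ).toContinuousLinearEquiv.toContinuousLinearMap.integral_comp_comm
      hint).symm
  have hint' : Integrable (fun l => (𝓕 (multiplierSemigroup hm hre l u) : L2R)) γ :=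
    (Lp.fourierTransformₗᵢ ℝ ℂ).toContinuousLinearEquiv.toContinuousLinearMap.integrable_comp hint
  have key : (𝓕 (∫ l, multiplierSemigroup hm hre l u ∂γ) : L2R) = hh.toLp := by
    rw [hcomm]
    -- Pairing with a test vector reduces the `L²`-valued integral to scalar ones, where Fubini
    -- applies.
    refine ext_inner_left ℂ fun g => ?_
    rw [← integral_inner hint' g, L2.inner_def]
    have hl : ∀ l : ℝ≥0, inner ℂ g (𝓕 (multiplierSemigroup hm hre l u) : L2R) =
        ∫ ξ, Complex.exp ((l : ℝ) * m ξ) * inner ℂ (g ξ) (f ξ) := fun l => by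
      rw [L2.inner_def]
      refine integral_congr_ae ?_
      filter_upwards [fourier_multiplierSemigroup hm hre l u] with ξ hξ
      rw [hξ, ← smul_eq_mul, inner_smul_right]
    simp only [hl]
    rw [integral_integral_swap]
    · refine integral_congr_ae ?_
      filter_upwards [hh.coeFn_toLp] with ξ hξ
      rw [hξ, ← smul_eq_mul, inner_smul_right, integral_mul_const]
    · have hgf : Integrable (fun ξ : ℝ => inner ℂ (g ξ) (f ξ)) := L2.integrable_inner g f
      refine Integrable.bdd_mul (c := 1) (hgf.comp_snd γ) hmeas.aestronglyMeasurable
        (Eventually.of_forall fun p => ?_)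
      exact norm_exp_mul_le_one hre p.1 p.2
  rw [key]
  exact hh.coeFn_toLp

/-- A bounded semigroup is determined by its generator, if this is densely defined. -/
theorem IsC0Semigroup.eq_of_isGeneratorOf {X : Type*} [NormedAddCommGroup X] [NormedSpace ℂ X]
    {A : X →ₗ.[ℂ] X} {V S : ℝ≥0 → X →L[ℂ] X} (hV : IsC0Semigroup V) (hS : IsC0Semigroup S)
    (hVb : ∃ M : ℝ, ∀ t, ‖V t‖ ≤ M) (hAV : IsGeneratorOf A V) (hAS : IsGeneratorOf A S)
    (hd : Dense {u : X | ∃ v, (u, v) ∈ A.graph}) : V = S := by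
  obtain ⟨M, hM⟩ := hVb
  have hM0 : 0 ≤ M := (norm_nonneg _).trans (hM 0)
  have hVle : ∀ t u, ‖V t u‖ ≤ M * ‖u‖ := fun t u => (V t).le_of_opNorm_le (hM t) u
  have hmem : ∀ s u v, (u, v) ∈ A.graph → (S s u, S s v) ∈ A.graph := by
    intro s u v huv
    rw [hAS] at huv ⊢
    refine (((S s).continuous.tendsto v).comp huv).congr fun h => ?_
    have e : S h (S s u) = S s (S h u) := by
      have h1 := congrArg (fun T => T u) (hS.map_add h s)
      have h2 := congrArg (fun T => T u) (hS.map_add s h)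
      rw [add_comm] at h2
      exact h1.symm.trans h2
    simp [e]
  funext t
  refine ContinuousLinearMap.ext_on (hd.mono Submodule.subset_span) ?_
  rintro u ⟨v, huv⟩
  -- The path `V (t - s) (S s u)` joins `V t u` to `S t u`. Its right derivative vanishes because `S
  -- s u` stays in the domain and both semigroups have the same derivative `A` there.
  have hcont : Continuous fun s : ℝ => V (t - s.toNNReal) (S s.toNNReal u) := by
    refine continuous_iff_continuousAt.2 fun s => ?_
    have h1 : Tendsto (fun r : ℝ => V (t - r.toNNReal) (S s.toNNReal u)) (𝓝 s)
        (𝓝 (V (t - s.toNNReal) (S s.toNNReal u))) := by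
      have : Continuous fun r : ℝ => V (t - r.toNNReal) (S s.toNNReal u) :=
        (hV.continuous _).comp (by fun_prop)
      exact this.tendsto s
    have h2 : Tendsto (fun r : ℝ => M * ‖S r.toNNReal u - S s.toNNReal u‖) (𝓝 s) (𝓝 0) := by
      have : Continuous fun r : ℝ => M * ‖S r.toNNReal u - S s.toNNReal u‖ :=
        continuous_const.mul
          ((((hS.continuous u).comp continuous_real_toNNReal).sub continuous_const).norm)
      simpa using this.tendsto s
    have h3 : Tendsto (fun r : ℝ => V (t - r.toNNReal) (S r.toNNReal u - S s.toNNReal u)) (𝓝 s)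
        (𝓝 0) := squeeze_zero_norm (fun r => hVle _ _) h2
    simpa [ContinuousAt] using h3.add h1
  have hderiv : ∀ s ∈ Set.Ico (0 : ℝ) t,
      HasDerivWithinAt (fun s : ℝ => V (t - s.toNNReal) (S s.toNNReal u)) 0 (Set.Ici s) s := by
    rintro s ⟨hs0, hst⟩
    lift s to ℝ≥0 using hs0
    have hst : s < t := by exact_mod_cast hst
    have hw := hmem s u v huv
    have h0 : Tendsto (fun r : ℝ => (r - s).toNNReal) (𝓝[>] (s : ℝ)) (𝓝[>] 0) := by
      refine tendsto_nhdsWithin_iff.2 ⟨?_, ?_⟩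
      · have : Continuous fun r : ℝ => (r - s).toNNReal := by fun_prop
        simpa using (this.tendsto (s : ℝ)).mono_left nhdsWithin_le_nhds
      · filter_upwards [self_mem_nhdsWithin] with r hr
        simpa using hr
    have hdiff := ((((hAS _ _).1 hw).comp h0).sub (((hAV _ _).1 hw).comp h0)).norm
    rw [sub_self, norm_zero] at hdiff
    rw [← hasDerivWithinAt_Ioi_iff_Ici,
      hasDerivWithinAt_iff_tendsto_slope' Set.self_notMem_Ioi]
    -- The outer operator `V d` with `d = t - r` varies with `r`, so the uniform bound `M` is what
    -- lets the difference of the two quotients force the slope to zero.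
    refine squeeze_zero_norm' ?_ (by simpa using hdiff.const_mul M)
    filter_upwards [Ioo_mem_nhdsGT (show (s : ℝ) < t by exact_mod_cast hst)] with r hr
    obtain ⟨h, rfl⟩ : ∃ h : ℝ≥0, r = s + h := ⟨(r - s).toNNReal, by
      rw [Real.coe_toNNReal _ (sub_nonneg.2 hr.1.le), add_sub_cancel]⟩
    obtain ⟨d, rfl⟩ : ∃ d : ℝ≥0, t = s + h + d :=
      exists_add_of_le (by exact_mod_cast hr.2.le)
    have e1 : V (s + h + d - s) = (V d).comp (V h) := by
      rw [add_assoc, add_tsub_cancel_left, add_comm, hV.map_add]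
    have e2 : S (s + h) = (S h).comp (S s) := by rw [add_comm, hS.map_add]
    have e3 : ((s : ℝ) + h).toNNReal = s + h := by
      rw [← NNReal.coe_add, Real.toNNReal_coe]
    have e4 : slope (fun r : ℝ => V (s + h + d - r.toNNReal) (S r.toNNReal u)) (s : ℝ) (s + h) =
        V d (((h : ℝ) : ℂ)⁻¹ • (S h (S s u) - S s u) -
          ((h : ℝ) : ℂ)⁻¹ • (V h (S s u) - S s u)) := by
      rw [slope_def_module, e3, Real.toNNReal_coe, e1, e2, add_tsub_cancel_left (s + h) d,
        add_sub_cancel_left, ← smul_sub, sub_sub_sub_cancel_right, map_smul, map_sub,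
        ← Complex.ofReal_inv, Complex.coe_smul]
      rfl
    rw [e4]
    refine (hVle _ _).trans_eq ?_
    simp
  have := constant_of_has_deriv_right_zero hcont.continuousOn hderiv t ⟨t.2, le_rfl⟩
  simpa [hV.map_zero, hS.map_zero] using this.symm

/-! ### The time derivative as a multiplier -/

/-- `timeDeriv` is the Fourier multiplier operator with symbol `2 π i ξ`. -/
theorem mem_graph_timeDeriv_iff_fourier (u v : L2R) :
    (u, v) ∈ timeDeriv.graph ↔ (𝓕 v : L2R) =ᵐ[volume]
      fun ξ => 2 * (Real.pi : ℂ) * Complex.I * ξ * (𝓕 u : L2R) ξ := by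
  rw [mem_graph_timeDeriv]
  have hF : Function.Injective (fun T : 𝓢'(ℝ, ℂ) => 𝓕 T) := fun S T h => by
    have h' : 𝓕⁻ (𝓕 S : 𝓢'(ℝ, ℂ)) = (𝓕⁻ (𝓕 T : 𝓢'(ℝ, ℂ)) : 𝓢'(ℝ, ℂ)) := congrArg _ h
    simpa using h'
  rw [← hF.eq_iff]
  simp only [TemperedDistribution.fourier_lineDerivOp_eq, Lp.fourier_toTemperedDistribution_eq]
  have hg : (fun x : ℝ => ((inner ℝ x (1 : ℝ) : ℝ) : ℂ)).HasTemperateGrowth := by fun_prop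
  have happ : ∀ g : 𝓢(ℝ, ℂ), ((2 * Real.pi * Complex.I : ℂ) •
      TemperedDistribution.smulLeftCLM ℂ (fun x : ℝ => ((inner ℝ x (1 : ℝ) : ℝ) : ℂ))
        ((𝓕 u : L2R) : 𝓢'(ℝ, ℂ))) g =
      ∫ ξ, g ξ * (2 * (Real.pi : ℂ) * Complex.I * ξ * (𝓕 u : L2R) ξ) := fun g => by
    change (2 * Real.pi * Complex.I : ℂ) • (TemperedDistribution.smulLeftCLM ℂ
      (fun x : ℝ => ((inner ℝ x (1 : ℝ) : ℝ) : ℂ)) ((𝓕 u : L2R) : 𝓢'(ℝ, ℂ))) g = _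
    rw [TemperedDistribution.smulLeftCLM_apply_apply,
      Lp.toTemperedDistribution_apply, smul_eq_mul, ← integral_const_mul]
    refine integral_congr_ae (Eventually.of_forall fun ξ => ?_)
    simp only [SchwartzMap.smulLeftCLM_apply_apply hg, smul_eq_mul]
    simp
    ring
  constructor
  · intro h
    -- Both sides are locally integrable, so equality against compactly supported smooth functions
    -- gives equality a.e.
    refine EventuallyEq.symm (ae_eq_of_integral_contDiff_smul_eq ?_ ?_ ?_)
    · have h1 : LocallyIntegrable (𝓕 u : L2R) volume :=
        (Lp.memLp _).locallyIntegrable (by norm_num)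
      exact LocallyIntegrable.continuous_smul
        (g := fun ξ : ℝ => 2 * (Real.pi : ℂ) * Complex.I * ξ) (by fun_prop) h1
    · exact (Lp.memLp _).locallyIntegrable (by norm_num)
    · intro g g_smooth g_cpt
      have hg₁ : HasCompactSupport (Complex.ofRealCLM ∘ g) := g_cpt.comp_left rfl
      have hg₂ : ContDiff ℝ ((⊤ : ℕ∞) : WithTop ℕ∞) (Complex.ofRealCLM ∘ g) := by fun_prop
      have := congrArg (fun T : 𝓢'(ℝ, ℂ) => T (hg₁.toSchwartzMap hg₂)) h
      simp only [happ] at this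
      simpa using this
  · intro h
    ext g
    rw [happ, Lp.toTemperedDistribution_apply]
    refine integral_congr_ae ?_
    filter_upwards [h] with ξ hξ
    rw [hξ, smul_eq_mul]

theorem smul_timeDeriv_eq_multiplierOp (c : ℂ) (hc : c ≠ 0) :
    c • timeDeriv = multiplierOp fun ξ => 2 * (Real.pi : ℂ) * Complex.I * c * ξ := by
  refine LinearPMap.eq_of_eq_graph (Submodule.ext ?_)
  rintro ⟨u, v⟩
  have h1 : (u, v) ∈ (c • timeDeriv).graph ↔ (u, c⁻¹ • v) ∈ timeDeriv.graph := by
    simp only [LinearPMap.mem_graph_iff]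
    constructor
    · rintro ⟨y, hy, h⟩
      refine ⟨y, hy, ?_⟩
      rw [← h, LinearPMap.smul_apply, inv_smul_smul₀ hc]
    · rintro ⟨y, hy, h⟩
      refine ⟨y, hy, ?_⟩
      rw [LinearPMap.smul_apply, h, smul_inv_smul₀ hc]
  rw [h1, mem_graph_timeDeriv_iff_fourier, mem_graph_multiplierOp]
  constructor
  · intro h
    filter_upwards [h, coeFn_fourier_smul c⁻¹ v] with ξ h2 h3
    rw [h3, inv_mul_eq_iff_eq_mul₀ hc] at h2
    rw [h2]
    ring
  · intro h
    filter_upwards [h, coeFn_fourier_smul c⁻¹ v] with ξ h2 h3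
    rw [h3, inv_mul_eq_iff_eq_mul₀ hc, h2]
    ring

/-! ### Laplace transforms of stable measures -/

/-- A non-integrable function has Bochner integral `0`, while the prescribed value is positive. -/
theorem HasStableLaplace.integrable {α : ℝ} {x : ℝ≥0} {γ : Measure ℝ≥0}
    (h : HasStableLaplace α x γ) {k : ℝ} (hk : 0 < k) :
    Integrable (fun l : ℝ≥0 => Real.exp (-((l : ℝ) * k))) γ := by
  by_contra hn
  have := h k hk
  rw [integral_undef hn] at this
  exact (Real.exp_pos _).ne this

/-- Fatou's lemma along `k = 1 / (n + 1) → 0`: the integrals are at most `1` and the integrands tend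
to `1`. -/
theorem HasStableLaplace.isFiniteMeasure {α : ℝ} {x : ℝ≥0} {γ : Measure ℝ≥0}
    (h : HasStableLaplace α x γ) : IsFiniteMeasure γ := by
  have hle : ∀ n : ℕ, ∫⁻ l : ℝ≥0, ENNReal.ofReal (Real.exp (-((l : ℝ) * (1 / ((n : ℝ) + 1))))) ∂γ
      ≤ 1 := fun n => by
    have hk : (0 : ℝ) < 1 / ((n : ℝ) + 1) := Nat.one_div_pos_of_nat
    rw [← ofReal_integral_eq_lintegral_ofReal (h.integrable hk)
      (Eventually.of_forall fun l => (Real.exp_pos _).le), h _ hk, ← ENNReal.ofReal_one]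
    refine ENNReal.ofReal_le_ofReal (Real.exp_le_one_iff.2 ?_)
    exact neg_nonpos.2 (mul_nonneg x.2 (Real.rpow_nonneg hk.le _))
  have hlim : ∀ l : ℝ≥0, liminf (fun n : ℕ =>
      ENNReal.ofReal (Real.exp (-((l : ℝ) * (1 / ((n : ℝ) + 1)))))) atTop = 1 := fun l => by
    refine Tendsto.liminf_eq ?_
    rw [← ENNReal.ofReal_one]
    refine ENNReal.tendsto_ofReal ?_
    have := ((tendsto_one_div_add_atTop_nhds_zero_nat (𝕜 := ℝ)).const_mul (l : ℝ)).neg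
    have h2 := (Real.continuous_exp.tendsto _).comp this
    simpa [Function.comp_def] using h2
  have := lintegral_liminf_le (μ := γ) (u := atTop) (fun n : ℕ => (by fun_prop : Measurable fun l : ℝ≥0 =>
      ENNReal.ofReal (Real.exp (-((l : ℝ) * (1 / ((n : ℝ) + 1)))))))
  simp only [hlim, lintegral_one] at this
  refine ⟨this.trans_lt ?_⟩
  refine (Filter.liminf_le_of_le (by isBoundedDefault) (a := 1) ?_).trans_lt ENNReal.one_lt_top
  rintro b hb
  obtain ⟨n, hn⟩ := hb.exists
  exact hn.trans (hle n)

/-- The branch cut meets the closed right half plane only at `0`, where `α > 0` gives continuity. -/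
theorem continuousAt_cpow_const_of_re_nonneg {α : ℝ} (hα : 0 < α) {z : ℂ} (hz : 0 ≤ z.re) :
    ContinuousAt (fun w : ℂ => w ^ (α : ℂ)) z := by
  rcases eq_or_ne z 0 with rfl | h0
  · exact (Complex.continuousAt_cpow_zero_of_re_pos (z := α) (by simpa using hα)).comp_of_eq
      (f := fun w : ℂ => (w, (α : ℂ))) (by fun_prop) rfl
  · refine continuousAt_id.cpow continuousAt_const ?_
    rw [id, Complex.mem_slitPlane_iff]
    by_contra! hn
    exact h0 (Complex.ext (le_antisymm hn.1 hz) hn.2)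

/-- The power multiplies the argument, at most `π / 2` in absolute value, by `α ≤ 1`. -/
theorem re_cpow_nonneg_of_re_nonneg {α : ℝ} (hα0 : 0 ≤ α) (hα1 : α ≤ 1) {z : ℂ} (hz : 0 ≤ z.re) :
    0 ≤ (z ^ (α : ℂ)).re := by
  rcases eq_or_ne z 0 with rfl | h0
  · rcases eq_or_ne α 0 with rfl | hα
    · simp
    · simp [Complex.zero_cpow, hα]
  · rw [Complex.cpow_def_of_ne_zero h0, Complex.exp_re]
    refine mul_nonneg (Real.exp_pos _).le (Real.cos_nonneg_of_mem_Icc ?_)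
    have h1 := Complex.abs_arg_le_pi_div_two_iff.2 hz
    have h2 : |z.arg * α| ≤ Real.pi / 2 := by
      rw [abs_mul, abs_of_nonneg hα0]
      nlinarith [abs_nonneg z.arg]
    rw [Set.mem_Icc, ← abs_le]
    simpa [Complex.log_im, mul_comm] using h2

/-- The Laplace transform of a stable measure on the closed right half plane. -/
theorem HasStableLaplace.integral_cexp {α : ℝ} (hα : 0 < α) {x : ℝ≥0} {γ : Measure ℝ≥0}
    (h : HasStableLaplace α x γ) {z : ℂ} (hz : 0 ≤ z.re) :
    ∫ l : ℝ≥0, Complex.exp ((l : ℝ) * -z) ∂γ = Complex.exp ((x : ℝ) * -z ^ (α : ℂ)) := by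
  have := h.isFiniteMeasure
  -- With this sign the Laplace transform is the complex moment generating function of `X`, analytic
  -- for `Re w > 0`. The identity theorem applies since the formula holds at real points
  -- accumulating at `1`.
  let X : ℝ≥0 → ℝ := fun l => -(l : ℝ)
  have hsub : Set.Ioi (0 : ℝ) ⊆ interior (ProbabilityTheory.integrableExpSet X γ) := by
    refine isOpen_Ioi.subset_interior_iff.2 fun k hk => ?_
    refine (h.integrable hk).congr (Eventually.of_forall fun l => ?_)
    simp only [X]
    ring_nf
  let H : Set ℂ := {w | 0 < w.re}
  have hF : AnalyticOnNhd ℂ (ProbabilityTheory.complexMGF X γ) H :=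
    ProbabilityTheory.analyticOnNhd_complexMGF.mono fun w hw => hsub hw
  have hG : AnalyticOnNhd ℂ (fun w : ℂ => Complex.exp ((x : ℝ) * -w ^ (α : ℂ))) H := by
    refine DifferentiableOn.analyticOnNhd (fun w hw => ?_)
      (isOpen_lt continuous_const Complex.continuous_re)
    have : w ∈ Complex.slitPlane := Or.inl hw
    exact ((((differentiableAt_id.cpow_const this).neg).const_mul _).cexp).differentiableWithinAt
  have hreal : ∀ k : ℝ, 0 < k → ProbabilityTheory.complexMGF X γ k =
      Complex.exp ((x : ℝ) * -(k : ℂ) ^ (α : ℂ)) := fun k hk => by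
    rw [ProbabilityTheory.complexMGF_ofReal, ProbabilityTheory.mgf, ← Complex.ofReal_cpow hk.le]
    have : ∫ l : ℝ≥0, Real.exp (k * X l) ∂γ = Real.exp (-((x : ℝ) * k ^ α)) := by
      rw [← h k hk]
      congr 1
      ext l
      simp only [X]
      ring_nf
    rw [this]
    push_cast
    ring_nf
  have hfreq : ∃ᶠ w in 𝓝[≠] (1 : ℂ), ProbabilityTheory.complexMGF X γ w =
      Complex.exp ((x : ℝ) * -w ^ (α : ℂ)) := by
    have ht : Tendsto (fun k : ℝ => (k : ℂ)) (𝓝[>] 1) (𝓝[≠] 1) := by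
      refine tendsto_nhdsWithin_iff.2 ⟨?_, ?_⟩
      · simpa using (Complex.continuous_ofReal.tendsto (1 : ℝ)).mono_left nhdsWithin_le_nhds
      · filter_upwards [self_mem_nhdsWithin] with k hk
        simpa using ne_of_gt (show (1 : ℝ) < k from hk)
    refine ht.frequently (Eventually.frequently ?_)
    filter_upwards [self_mem_nhdsWithin] with k hk
    exact hreal k (zero_lt_one.trans hk)
  have heq : Set.EqOn (ProbabilityTheory.complexMGF X γ)
      (fun w : ℂ => Complex.exp ((x : ℝ) * -w ^ (α : ℂ))) H :=
    hF.eqOn_of_preconnected_of_frequently_eq hG (convex_halfSpace_re_gt 0).isPreconnected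
      (show (0 : ℝ) < (1 : ℂ).re by simp) hfreq
  -- The boundary is reached by shifting `z` to `z + ε`; finiteness of `γ` makes the constant `1` an
  -- integrable majorant.
  have happrox : Tendsto (fun ε : ℝ => z + ε) (𝓝[>] 0) (𝓝 z) := by
    have : Continuous fun ε : ℝ => z + ε := by fun_prop
    simpa using (this.tendsto 0).mono_left nhdsWithin_le_nhds
  have hlimF : Tendsto (fun ε : ℝ => ∫ l : ℝ≥0, Complex.exp ((l : ℝ) * -(z + ε)) ∂γ) (𝓝[>] 0)
      (𝓝 (∫ l : ℝ≥0, Complex.exp ((l : ℝ) * -z) ∂γ)) := by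
    refine tendsto_integral_filter_of_dominated_convergence (fun _ => 1)
      (Eventually.of_forall fun ε => (by fun_prop : Measurable fun l : ℝ≥0 =>
        Complex.exp ((l : ℝ) * -(z + ε))).aestronglyMeasurable) ?_ (integrable_const _) ?_
    · filter_upwards [self_mem_nhdsWithin] with ε hε
      refine Eventually.of_forall fun l => ?_
      rw [Complex.norm_exp, Real.exp_le_one_iff, Complex.re_ofReal_mul, Complex.neg_re,
        Complex.add_re, Complex.ofReal_re]
      have : (0 : ℝ) < ε := hε
      exact mul_nonpos_of_nonneg_of_nonpos l.2 (by linarith)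
    · refine Eventually.of_forall fun l => ?_
      exact ((Complex.continuous_exp.tendsto _).comp (happrox.neg.const_mul _))
  have hlimG : Tendsto (fun ε : ℝ => Complex.exp ((x : ℝ) * -(z + ε) ^ (α : ℂ))) (𝓝[>] 0)
      (𝓝 (Complex.exp ((x : ℝ) * -z ^ (α : ℂ)))) :=
    (Complex.continuous_exp.tendsto _).comp
      (((continuousAt_cpow_const_of_re_nonneg hα hz).tendsto.comp happrox).neg.const_mul _)
  refine tendsto_nhds_unique (hlimF.congr' ?_) hlimG
  filter_upwards [self_mem_nhdsWithin] with ε hε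
  have hε : (0 : ℝ) < ε := hε
  have hmem : z + ε ∈ H := by
    change 0 < (z + ε).re
    rw [Complex.add_re, Complex.ofReal_re]
    linarith
  refine Eq.trans ?_ (heq hmem)
  rw [ProbabilityTheory.complexMGF]
  congr 1
  ext l
  simp only [X]
  push_cast
  ring_nf

/-! ### Existence of the one-sided stable measures -/

/-- `g` is the moment function `k ↦ ∫ y ^ k dν(y)` of a probability measure on `[0, 1]`. -/
def IsMomentFunction (g : ℝ → ℝ) : Prop :=
  ∃ ν : ProbabilityMeasure unitInterval, ∀ k : ℝ, 0 < k →
    ∫ y : unitInterval, (y : ℝ) ^ k ∂(ν : Measure unitInterval) = g k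

theorem continuous_unitInterval_rpow {k : ℝ} (hk : 0 < k) :
    Continuous fun y : unitInterval => (y : ℝ) ^ k :=
  continuous_subtype_val.rpow_const fun _ => Or.inr hk.le

theorem isMomentFunction_one : IsMomentFunction fun _ => 1 :=
  ⟨⟨Measure.dirac 1, inferInstance⟩, fun k _ => by simp⟩

/-- The product of two independent random variables has the product of their moments. -/
theorem IsMomentFunction.mul {f g : ℝ → ℝ} (hf : IsMomentFunction f) (hg : IsMomentFunction g) :
    IsMomentFunction fun k => f k * g k := by
  obtain ⟨ν, hν⟩ := hf
  obtain ⟨ρ, hρ⟩ := hg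
  have hm : Measurable fun p : unitInterval × unitInterval => p.1 * p.2 :=
    continuous_mul.measurable
  refine ⟨⟨((ν : Measure unitInterval).prod (ρ : Measure unitInterval)).map
    fun p => p.1 * p.2, Measure.isProbabilityMeasure_map hm.aemeasurable⟩, fun k hk => ?_⟩
  rw [ProbabilityMeasure.coe_mk, integral_map hm.aemeasurable
    (continuous_unitInterval_rpow hk).aestronglyMeasurable]
  simp only [← hν k hk, ← hρ k hk]
  rw [← integral_prod_mul]
  refine integral_congr_ae (Eventually.of_forall fun p => ?_)
  simp only [Set.Icc.coe_mul]
  exact Real.mul_rpow p.1.2.1 p.2.2.1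

theorem IsMomentFunction.pow {f : ℝ → ℝ} (hf : IsMomentFunction f) (n : ℕ) :
    IsMomentFunction fun k => f k ^ n := by
  induction n with
  | zero => simpa using isMomentFunction_one
  | succ n ih => simpa only [pow_succ] using ih.mul hf

/-- Probability measures on a compact interval form a compact space, so an ultrafilter limit exists;
`y ^ k` is continuous there. Mass may accumulate at `y = 0`, that is `l = ∞`. -/
theorem IsMomentFunction.of_tendsto {f : ℕ → ℝ → ℝ} {g : ℝ → ℝ} (hf : ∀ n, IsMomentFunction (f n))
    (hlim : ∀ k, 0 < k → Tendsto (fun n => f n k) atTop (𝓝 (g k))) : IsMomentFunction g := by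
  choose ν hν using hf
  let U : Ultrafilter ℕ := Ultrafilter.of atTop
  have hU : Tendsto ν U (𝓝 (U.map ν).lim) := (U.map ν).le_nhds_lim
  refine ⟨(U.map ν).lim, fun k hk => ?_⟩
  have h1 := ProbabilityMeasure.tendsto_iff_forall_integral_tendsto.1 hU
    (BoundedContinuousFunction.mkOfCompact ⟨_, continuous_unitInterval_rpow hk⟩)
  refine tendsto_nhds_unique h1 (((hlim k hk).mono_left (Ultrafilter.of_le atTop)).congr ?_)
  intro n
  exact (hν n k hk).symm

/-- Place mass `w n` at `q ^ n` and the missing mass at `0`, where `0 ^ k = 0`. -/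
theorem isMomentFunction_sum_pow {w : ℕ → ℝ} (hw : ∀ n, 0 ≤ w n) (N : ℕ)
    (hsum : ∑ n ∈ Finset.range N, w n ≤ 1) (q : unitInterval) :
    IsMomentFunction fun k => ∑ n ∈ Finset.range N, w n * ((q : ℝ) ^ k) ^ n := by
  let ν : Measure unitInterval :=
    ∑ n ∈ Finset.range N, ENNReal.ofReal (w n) • Measure.dirac (q ^ n) +
      ENNReal.ofReal (1 - ∑ n ∈ Finset.range N, w n) • Measure.dirac 0
  have hν : IsProbabilityMeasure ν := by
    constructor
    simp only [ν, Measure.add_apply, Measure.coe_finsetSum, Finset.sum_apply, Measure.smul_apply,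
      measure_univ, smul_eq_mul, mul_one]
    rw [← ENNReal.ofReal_sum_of_nonneg fun n _ => hw n,
      ← ENNReal.ofReal_add (Finset.sum_nonneg fun n _ => hw n) (sub_nonneg.2 hsum)]
    simp
  refine ⟨⟨ν, hν⟩, fun k hk => ?_⟩
  have hi : ∀ ρ : Measure unitInterval, IsFiniteMeasure ρ →
      Integrable (fun y : unitInterval => (y : ℝ) ^ k) ρ := fun ρ _ =>
    (continuous_unitInterval_rpow hk).integrable_of_hasCompactSupport
      (HasCompactSupport.of_compactSpace _)
  have hfin : ∀ (a : ℝ) (y : unitInterval),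
      IsFiniteMeasure (ENNReal.ofReal a • Measure.dirac y) := fun a y =>
    Measure.smul_finite _ ENNReal.ofReal_ne_top
  rw [ProbabilityMeasure.coe_mk, integral_add_measure (hi _ inferInstance) (hi _ (hfin _ _)),
    integral_finsetSum_measure fun n _ => hi _ (hfin _ _)]
  simp only [integral_smul_measure, integral_dirac, Set.Icc.coe_zero, Real.zero_rpow hk.ne',
    smul_eq_mul, mul_zero, add_zero, Set.Icc.coe_pow]
  refine Finset.sum_congr rfl fun n _ => ?_
  rw [ENNReal.toReal_ofReal (hw n), ← Real.rpow_natCast, ← Real.rpow_natCast, ← Real.rpow_mul q.2.1,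
    ← Real.rpow_mul q.2.1, mul_comm k]

/-- The coefficients of the power series of `1 - (1 - y) ^ α`. -/
noncomputable def sibuyaCoeff (α : ℝ) (n : ℕ) : ℝ :=
  if n = 0 then 0 else -((-1) ^ n * Ring.choose α n)

theorem ring_choose_succ_mul (α : ℝ) (n : ℕ) :
    Ring.choose α (n + 1) * (n + 1) = Ring.choose α n * (α - n) := by
  have h1 := Ring.descPochhammer_eq_factorial_smul_choose α n
  have h2 := Ring.descPochhammer_eq_factorial_smul_choose α (n + 1)
  rw [descPochhammer_succ_right, Polynomial.smeval_mul, h1] at h2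
  have hf : (n.factorial : ℝ) ≠ 0 := by exact_mod_cast n.factorial_ne_zero
  simp [Polynomial.smeval_sub, Nat.factorial_succ, Polynomial.smeval_natCast] at h2
  refine mul_left_cancel₀ hf ?_
  linarith

/-- For `n ≥ 1` consecutive coefficients have ratio `(n - α) / (n + 1) ≥ 0`, and the first is `α`.
-/
theorem sibuyaCoeff_nonneg {α : ℝ} (hα0 : 0 ≤ α) (hα1 : α ≤ 1) (n : ℕ) : 0 ≤ sibuyaCoeff α n := by
  rcases n with _ | n
  · simp [sibuyaCoeff]
  · induction n with
    | zero => simpa [sibuyaCoeff] using hα0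
    | succ n ih =>
      have h := ring_choose_succ_mul α (n + 1)
      simp only [sibuyaCoeff, Nat.succ_ne_zero, if_false] at ih ⊢
      have e : -((-1) ^ (n + 1 + 1) * Ring.choose α (n + 1 + 1)) * ((n : ℝ) + 2) =
          -((-1) ^ (n + 1) * Ring.choose α (n + 1)) * (n + 1 - α) := by
        push_cast at h
        rw [pow_succ _ (n + 1)]
        linear_combination ((-1) ^ (n + 1)) * h
      have hn : (0 : ℝ) < (n : ℝ) + 2 := by positivity
      have hr : (0 : ℝ) ≤ n + 1 - α := by
        have : (0 : ℝ) ≤ n := n.cast_nonneg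
        linarith
      exact nonneg_of_mul_nonneg_left (e ▸ mul_nonneg ih hr) hn

theorem hasSum_sibuyaCoeff (α : ℝ) {y : ℝ} (h0 : 0 ≤ y) (h1 : y < 1) :
    HasSum (fun n => sibuyaCoeff α n * y ^ n) (1 - (1 - y) ^ α) := by
  have hy : -y ∈ Metric.eball (0 : ℝ) 1 := by
    rw [← ENNReal.ofReal_one, Metric.eball_ofReal]
    simpa [abs_of_nonneg h0] using h1
  have h := (Real.one_add_rpow_hasFPowerSeriesOnBall_zero (a := α)).hasSum hy
  simp only [binomialSeries_apply, zero_add, List.ofFn_const, List.prod_replicate, smul_eq_mul] at h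
  have h2 := (hasSum_ite_eq 0 (1 : ℝ)).sub h
  rw [← sub_eq_add_neg] at h2
  convert! h2 using 1
  ext n
  rcases n with _ | n
  · simp [sibuyaCoeff]
  · simp only [sibuyaCoeff, Nat.succ_ne_zero, if_false, neg_pow y (n + 1)]
    ring

/-- Nonnegative partial sums at `y < 1` stay below `1 - (1 - y) ^ α ≤ 1`; let `y → 1`. -/
theorem sum_sibuyaCoeff_le_one {α : ℝ} (hα0 : 0 ≤ α) (hα1 : α ≤ 1) (N : ℕ) :
    ∑ n ∈ Finset.range N, sibuyaCoeff α n ≤ 1 := by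
  have hcont : Continuous fun y : ℝ => ∑ n ∈ Finset.range N, sibuyaCoeff α n * y ^ n := by fun_prop
  have hlim := (hcont.tendsto 1).mono_left (nhdsWithin_le_nhds (s := Set.Iio 1))
  simp only [one_pow, mul_one] at hlim
  refine le_of_tendsto hlim ?_
  filter_upwards [Ioo_mem_nhdsLT zero_lt_one] with y hy
  have h := hasSum_sibuyaCoeff α hy.1.le hy.2
  refine (sum_le_hasSum _ (fun n _ => mul_nonneg (sibuyaCoeff_nonneg hα0 hα1 n)
    (pow_nonneg hy.1.le n)) h).trans ?_
  have := Real.rpow_nonneg (sub_nonneg.2 hy.2.le) α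
  linarith

theorem isMomentFunction_one_sub_rpow {α : ℝ} (hα0 : 0 ≤ α) (hα1 : α ≤ 1) {h : ℝ} (hh : 0 < h) :
    IsMomentFunction fun k => 1 - (1 - Real.exp (-(h * k))) ^ α := by
  let q : unitInterval := ⟨Real.exp (-h), (Real.exp_pos _).le,
    Real.exp_le_one_iff.2 (neg_nonpos.2 hh.le)⟩
  refine IsMomentFunction.of_tendsto (fun N => isMomentFunction_sum_pow
    (sibuyaCoeff_nonneg hα0 hα1) N (sum_sibuyaCoeff_le_one hα0 hα1 N) q) fun k hk => ?_
  have e : (q : ℝ) ^ k = Real.exp (-(h * k)) := by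
    rw [← neg_mul, Real.exp_mul]
  rw [e]
  exact (hasSum_sibuyaCoeff α (Real.exp_pos _).le
    (Real.exp_lt_one_iff.2 (neg_lt_zero.2 (mul_pos hh hk)))).tendsto_sum_nat

theorem isMomentFunction_exp_neg_rpow {α : ℝ} (hα0 : 0 < α) (hα1 : α ≤ 1) {x : ℝ} (hx : 0 ≤ x) :
    IsMomentFunction fun k => Real.exp (-(x * k ^ α)) := by
  rcases hx.eq_or_lt with rfl | hx
  · simpa using isMomentFunction_one
  -- Chosen so that `h n ^ α = x / n`: then `(1 - exp (-h n k)) ^ α` is asymptotically `x k ^ α /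
  -- n`, and the `n`-th powers converge to the exponential.
  let h : ℕ → ℝ := fun n => (x / n) ^ α⁻¹
  have hpos : ∀ n : ℕ, n ≠ 0 → 0 < h n := fun n hn =>
    Real.rpow_pos_of_pos (div_pos hx (Nat.cast_pos.2 (Nat.pos_of_ne_zero hn))) _
  have hpow : ∀ n : ℕ, h n ^ α = x / n := fun n =>
    Real.rpow_inv_rpow (div_nonneg hx.le n.cast_nonneg) hα0.ne'
  have h0 : Tendsto h atTop (𝓝[>] 0) := by
    refine tendsto_nhdsWithin_iff.2 ⟨?_, ?_⟩
    · have := (tendsto_const_div_atTop_nhds_zero_nat x).rpow_const (p := α⁻¹)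
        (Or.inr (inv_nonneg.2 hα0.le))
      rwa [Real.zero_rpow (inv_ne_zero hα0.ne')] at this
    · filter_upwards [eventually_ne_atTop 0] with n hn
      exact hpos n hn
  refine IsMomentFunction.of_tendsto
    (f := fun n k => (1 + -(1 - Real.exp (-(h n * k))) ^ α) ^ n) (fun n => ?_) fun k hk => ?_
  · rcases eq_or_ne n 0 with rfl | hn
    · simpa using isMomentFunction_one
    · simp only [← sub_eq_add_neg]
      exact (isMomentFunction_one_sub_rpow hα0.le hα1 (hpos n hn)).pow n
  · refine Real.tendsto_one_add_pow_exp_of_tendsto ?_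
    have hd : HasDerivAt (fun t : ℝ => 1 - Real.exp (-(t * k))) k 0 := by
      simpa using ((((hasDerivAt_id (0 : ℝ)).mul_const k).neg).exp).const_sub 1
    have hs : Tendsto (fun t : ℝ => (1 - Real.exp (-(t * k))) / t) (𝓝[>] 0) (𝓝 k) := by
      have := hd.tendsto_slope_zero_right
      simpa [div_eq_inv_mul] using this
    have hl := (((hs.comp h0).rpow_const (p := α) (Or.inr hα0.le)).const_mul x).neg
    refine hl.congr' ?_
    filter_upwards [eventually_ne_atTop 0] with n hn
    have hle : 0 ≤ 1 - Real.exp (-(h n * k)) :=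
      sub_nonneg.2 (Real.exp_le_one_iff.2 (neg_nonpos.2 (mul_pos (hpos n hn) hk).le))
    have hn' : (n : ℝ) ≠ 0 := Nat.cast_ne_zero.2 hn
    simp only [Function.comp_apply]
    rw [Real.div_rpow hle (hpos n hn).le, hpow]
    field_simp

/-- The one-sided stable distributions. -/
theorem exists_hasStableLaplace {α : ℝ} (hα0 : 0 < α) (hα1 : α ≤ 1) (x : ℝ≥0) :
    ∃ γ : Measure ℝ≥0, HasStableLaplace α x γ := by
  obtain ⟨ν, hν⟩ := isMomentFunction_exp_neg_rpow hα0 hα1 x.2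
  have hseq := tendsto_one_div_add_atTop_nhds_zero_nat (𝕜 := ℝ)
  have hpos : ∀ n : ℕ, (0 : ℝ) < 1 / ((n : ℝ) + 1) := fun n => Nat.one_div_pos_of_nat
  -- As `k → 0` the moments tend both to `1` and to the mass off `0`, so `ν` has no atom at `0` and
  -- `-log y` is a genuine finite variable almost surely.
  have hlim1 : Tendsto (fun n : ℕ => ∫ y : unitInterval, (y : ℝ) ^ (1 / ((n : ℝ) + 1))
      ∂(ν : Measure unitInterval)) atTop (𝓝 1) := by
    simp only [hν _ (hpos _)]
    have := ((hseq.rpow_const (p := α) (Or.inr hα0.le)).const_mul (x : ℝ)).neg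
    rw [Real.zero_rpow hα0.ne', mul_zero, neg_zero] at this
    simpa [Function.comp_def] using (Real.continuous_exp.tendsto 0).comp this
  have hlim2 : Tendsto (fun n : ℕ => ∫ y : unitInterval, (y : ℝ) ^ (1 / ((n : ℝ) + 1))
      ∂(ν : Measure unitInterval)) atTop
      (𝓝 (∫ y, Set.indicator {0}ᶜ (fun _ => (1 : ℝ)) y ∂(ν : Measure unitInterval))) := by
    refine tendsto_integral_of_dominated_convergence (fun _ => 1)
      (fun n => (continuous_unitInterval_rpow (hpos n)).aestronglyMeasurable) (integrable_const _)
      (fun n => Eventually.of_forall fun y => ?_) (Eventually.of_forall fun y => ?_)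
    · rw [Real.norm_of_nonneg (Real.rpow_nonneg y.2.1 _)]
      exact Real.rpow_le_one y.2.1 y.2.2 (hpos n).le
    · rcases eq_or_ne y 0 with rfl | hy
      · simp only [Set.Icc.coe_zero, Real.zero_rpow (hpos _).ne']
        simp
      · have hy' : (y : ℝ) ≠ 0 := fun h => hy (Subtype.ext h)
        have := (Real.continuousAt_const_rpow (b := 0) hy').tendsto.comp hseq
        simpa [hy, Function.comp_def] using this
  have hone := tendsto_nhds_unique hlim2 hlim1
  rw [integral_indicator_const _ (measurableSet_singleton _).compl, smul_eq_mul, mul_one] at hone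
  have hae : ∀ᵐ y ∂(ν : Measure unitInterval), y ∈ ({0}ᶜ : Set unitInterval) := by
    have h1 : (ν : Measure unitInterval) {0}ᶜ = 1 := by
      rw [← ENNReal.ofReal_one, ← hone, ofReal_measureReal]
    exact (mem_ae_iff_prob_eq_one (measurableSet_singleton _).compl).2 h1
  have hm : Measurable fun y : unitInterval => (-Real.log y).toNNReal := by fun_prop
  refine ⟨(ν : Measure unitInterval).map fun y : unitInterval => (-Real.log y).toNNReal, fun k hk => ?_⟩
  rw [integral_map hm.aemeasurable (by fun_prop)]
  refine Eq.trans ?_ (hν k hk)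
  refine integral_congr_ae ?_
  filter_upwards [hae] with y hy
  have hy0 : (0 : ℝ) < y := lt_of_le_of_ne y.2.1 fun h => hy (Subtype.ext h.symm)
  rw [Real.coe_toNNReal _ (neg_nonneg.2 (Real.log_nonpos y.2.1 y.2.2)), neg_mul, neg_neg,
    Real.rpow_def_of_pos hy0]

/-! ### Fractional powers of multiplier operators -/

/-- The measure enters only through its Laplace transform, so any admissible `γ` yields the same
operator and its own uniqueness need not be proved. -/
theorem integral_multiplierSemigroup_of_hasStableLaplace {α : ℝ} (hα : 0 < α) {m s : ℝ → ℂ}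
    (hm : Measurable m) (hmre : ∀ ξ, (m ξ).re ≤ 0) (hs : Measurable s) (hsre : ∀ ξ, (s ξ).re ≤ 0)
    (hms : ∀ ξ, s ξ = -(-m ξ) ^ (α : ℂ)) {x : ℝ≥0} {γ : Measure ℝ≥0} (h : HasStableLaplace α x γ)
    (u : L2R) :
    ∫ l, multiplierSemigroup hm hmre l u ∂γ = multiplierSemigroup hs hsre x u := by
  have := h.isFiniteMeasure
  refine eq_of_fourier_ae_eq ?_
  filter_upwards [fourier_integral_multiplierSemigroup hm hmre γ u,
    fourier_multiplierSemigroup hs hsre x u] with ξ h1 h2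
  have hz : 0 ≤ (-m ξ).re := by
    rw [Complex.neg_re]
    exact neg_nonneg.2 (hmre ξ)
  have h3 := h.integral_cexp hα hz
  rw [neg_neg, ← hms] at h3
  rw [h1, h2, h3]

theorem IsGeneratorOf.eq {X : Type*} [NormedAddCommGroup X] [NormedSpace ℂ X]
    {A B : X →ₗ.[ℂ] X} {T : ℝ≥0 → X →L[ℂ] X} (hA : IsGeneratorOf A T) (hB : IsGeneratorOf B T) :
    A = B :=
  LinearPMap.eq_of_eq_graph (Submodule.ext fun p => (hA p.1 p.2).trans (hB p.1 p.2).symm)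

/-- The fractional powers of a dissipative Fourier multiplier operator. -/
theorem isBochnerPhillipsPower_multiplierOp_iff {α : ℝ} (hα0 : 0 < α) (hα1 : α ≤ 1) {m s : ℝ → ℂ}
    (hm : Measurable m) (hmre : ∀ ξ, (m ξ).re ≤ 0) (hs : Measurable s) (hsre : ∀ ξ, (s ξ).re ≤ 0)
    (hms : ∀ ξ, s ξ = -(-m ξ) ^ (α : ℂ)) (B : L2R →ₗ.[ℂ] L2R) :
    IsBochnerPhillipsPower α (multiplierOp m) B ↔ B = multiplierOp s := by
  have hT := isC0Semigroup_multiplierSemigroup hm hmre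
  have hgen := isGeneratorOf_multiplierOp hm hmre
  constructor
  · rintro ⟨V, γ, W, hV, hVb, hAV, hγ, hW, hB⟩
    obtain rfl := hV.eq_of_isGeneratorOf hT hVb hAV hgen (dense_domain_multiplierOp hm)
    have hWs : W = multiplierSemigroup hs hsre := by
      funext x
      ext1 u
      exact (hW x u).trans
        (integral_multiplierSemigroup_of_hasStableLaplace hα0 hm hmre hs hsre hms (hγ x) u)
    exact hB.eq (hWs ▸ isGeneratorOf_multiplierOp hs hsre)
  · rintro rfl
    choose γ hγ using exists_hasStableLaplace hα0 hα1
    exact ⟨_, γ, multiplierSemigroup hs hsre, hT, ⟨1, norm_multiplierSemigroup_le hm hmre⟩, hgen,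
      hγ, fun x u => (integral_multiplierSemigroup_of_hasStableLaplace hα0 hm hmre hs hsre hms
        (hγ x) u).symm, isGeneratorOf_multiplierOp hs hsre⟩

theorem lemma2 (μ α : ℝ) (hμ : 0 < μ) (hα0 : 0 < α) (hα1 : α < 1)
    (c : ℝ) (hc : c = √μ ∨ c = -√μ) :
    ∃ B : L2R →ₗ.[ℂ] L2R,
      (∀ B' : L2R →ₗ.[ℂ] L2R,
        IsBochnerPhillipsPower α ((c : ℂ) • timeDeriv) B' ↔ B' = B) ∧
      IsInfinitesimalGenerator B ∧
      ∀ u v : L2R, (u, v) ∈ B.graph ↔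
        (𝓕 v : L2R) =ᵐ[volume] fun ξ : ℝ =>
          -((-(2 * (Real.pi : ℂ) * Complex.I * (c : ℂ) * (ξ : ℂ))) ^ (α : ℂ)) *
            (𝓕 u : L2R) ξ := by
  have hc0 : (c : ℂ) ≠ 0 := by
    have := Real.sqrt_pos.2 hμ
    rcases hc with rfl | rfl <;> simp [this.ne']
  have hre : ∀ ξ : ℝ, (2 * (Real.pi : ℂ) * Complex.I * c * ξ).re = 0 := fun ξ => by simp
  have hs : Measurable fun ξ : ℝ => -((-(2 * (Real.pi : ℂ) * Complex.I * c * ξ)) ^ (α : ℂ)) := by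
    fun_prop
  have hsre : ∀ ξ : ℝ, (-((-(2 * (Real.pi : ℂ) * Complex.I * c * ξ)) ^ (α : ℂ))).re ≤ 0 :=
    fun ξ => by
      rw [Complex.neg_re, neg_nonpos]
      refine re_cpow_nonneg_of_re_nonneg hα0.le hα1.le ?_
      rw [Complex.neg_re, hre, neg_zero]
  refine ⟨_, fun B' => ?_, ⟨_, isC0Semigroup_multiplierSemigroup hs hsre,
    isGeneratorOf_multiplierOp hs hsre⟩, mem_graph_multiplierOp _⟩
  rw [smul_timeDeriv_eq_multiplierOp _ hc0]
  exact isBochnerPhillipsPower_multiplierOp_iff hα0 hα1.le (by fun_prop) (fun ξ => (hre ξ).le)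
    hs hsre (fun _ => rfl) B'
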